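/- Let $k$ be a field. Let $\mathbf{Art}$ be the category of Artinian local $k$-algebras with residue field $k$, and let $\mathrm{QCoh}$ be the category of pairs $(X,M)$ with $X$ a $k$-scheme and $M$ a quasi-coherent sheaf on $X$, a morphism $(X,M)\to(Y,N)$ being a $k$-morphism $f:X\to Y$ together with an $\mathcal{O}_Y$-linear map $N\to f_*M$. For a $k$-scheme $X$ and $A\in\mathbf{Art}$, a deformation of $X$ over $A$ is a flat $A$-scheme $\mathcal{X}$ with a closed immersion $X\to\mathcal{X}$ that identifies $X$ with $\mathcal{X}\times_{\operatorname{Spec}A}\operatorname{Spec}k$; an isomorphism of deformations is an $A$-isomorphism compatible with the immersions of $X$. Let $D_X:\mathbf{Art}\to\mathbf{Sets}$ be the functor of isomorphism classes of deformations of $X$, with base change. A fibered deformation of $X$ over $A$ is a pair $(\mathcal{X},\Omega_{\mathcal{X}/k})$ with $\mathcal{X}$ a deformation of $X$ over $A$ (the second member being a sheaf on $\mathcal{X}$ isomorphic to $\Omega_{\mathcal{X}/k}$); an isomorphism of fibered deformations is an isomorphism of deformations together with an isomorphism of the sheaves over it. Let $D_{\Omega_{X/k}}:\mathbf{Art}\to\mathbf{Sets}$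 be the functor of isomorphism classes of fibered deformations of $X$, where $B\to A$ sends the class of $(\mathcal{X},\Omega_{\mathcal{X}/k})$ to that of $(\mathcal{X}_A,\Omega_{\mathcal{X}_A/k})$ with $\mathcal{X}_A=\mathcal{X}\times_{\operatorname{Spec}B}\operatorname{Spec}A$. Then $X\mapsto(X,\Omega_{X/k})$ is a functor from the category of $k$-schemes to $\mathrm{QCoh}$ (in particular each $\Omega_{X/k}$ is quasi-coherent), and it is smooth in the following sense: for every $k$-scheme $X$, the assignment $\mathcal{X}\mapsto(\mathcal{X},\Omega_{\mathcal{X}/k})$ is a well-defined morphism of functors $\Theta_X:D_X\to D_{\Omega_{X/k}}$, and for every surjective morphism $B\to A$ in $\mathbf{Art}$ the map $$D_X(B)\to D_X(A)\times_{D_{\Omega_{X/k}}(A)}D_{\Omega_{X/k}}(B)$$ is surjective. -/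

import Mathlib

open CategoryTheory AlgebraicGeometry Opposite

universe u

noncomputable section

namespace OmegaSmooth

variable {k : Type u} [Field k]
/-! ### The sheaf of differentials of a scheme over a field -/

/-- The structure map `k → Γ(X, U)` of a `k`-scheme, as a morphism of presheaves of rings from
the constant presheaf `k`. -/
def structMap (X : Over (Spec (.of k))) :
    (Functor.const _).obj (CommRingCat.of k) ⟶ X.left.presheaf where
  app U := (Scheme.ΓSpecIso (.of k)).inv ≫ X.hom.appLE ⊤ U.unop (by simp)
  naturality U V f := by
    simpa using (Scheme.Hom.appLE_map X.hom (by simp) f).symm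

/-- The presheaf of modules `U ↦ Ω_{Γ(X, U)/k}`. -/
def preOmega (X : Over (Spec (.of k))) : X.left.PresheafOfModules :=
  PresheafOfModules.DifferentialsConstruction.relativeDifferentials' (structMap X)

/-- The sheaf of differentials `Ω_{X/k}`: the sheaf of `𝒪_X`-modules associated with the presheaf
`U ↦ Ω_{Γ(X, U)/k}`. -/
def omegaSheaf (X : Over (Spec (.of k))) : X.left.Modules :=
  (PresheafOfModules.sheafification (𝟙 X.left.ringCatSheaf.obj)).obj (preOmega X)

/-- The `k`-derivations of `𝒪_X` with values in a sheaf of `𝒪_X`-modules `M`. -/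
structure Deriv (X : Over (Spec (.of k))) (M : X.left.Modules) where
  d (U : X.left.Opens) : Γ(X.left, U) →+ Γ(M, U)
  d_mul (U : X.left.Opens) (a b : Γ(X.left, U)) : d U (a * b) = a • d U b + b • d U a
  d_map {U V : X.left.Opens} (i : U ⟶ V) (a : Γ(X.left, V)) :
    d U (X.left.presheaf.map i.op a) = M.presheaf.map i.op (d V a)
  d_const (U : X.left.Opens) (c : k) : d U ((structMap X).app (op U) c) = 0

/-- The canonical map from the presheaf of differentials to its associated sheaf. -/
def toOmega (X : Over (Spec (.of k))) :
    preOmega X ⟶ (PresheafOfModules.restrictScalars (𝟙 X.left.ringCatSheaf.obj)).obj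
      ((SheafOfModules.forget _).obj (omegaSheaf X)) :=
  (PresheafOfModules.sheafificationAdjunction (𝟙 X.left.ringCatSheaf.obj)).unit.app (preOmega X)

/-- The universal derivation, in Mathlib's form. -/
def preDeriv (X : Over (Spec (.of k))) : PresheafOfModules.Derivation'
   ((PresheafOfModules.restrictScalars (𝟙 X.left.ringCatSheaf.obj)).obj
      ((SheafOfModules.forget _).obj (omegaSheaf X))) (structMap X) :=
  (PresheafOfModules.DifferentialsConstruction.derivation' (structMap X)).postcomp (toOmega X)

/-- The universal derivation `d : 𝒪_X → Ω_{X/k}`. -/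
def univDeriv (X : Over (Spec (.of k))) : Deriv X (omegaSheaf X) where
  d U := (preDeriv X).d (X := op U)
  d_mul U a b := (preDeriv X).d_mul (X := op U) a b
  d_map i a := (preDeriv X).d_map i.op a
  d_const U c := (preDeriv X).d_app (X := op U) c

variable {X Y : Over (Spec (.of k))}
/-- A derivation, in Mathlib's form. -/
def Deriv.toDerivation' {M : X.left.Modules} (D : Deriv X M) : PresheafOfModules.Derivation'
   ((PresheafOfModules.restrictScalars (𝟙 X.left.ringCatSheaf.obj)).obj
      ((SheafOfModules.forget _).obj M)) (structMap X) where
  d {U} := D.d U.unop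
  d_mul {U} a b := D.d_mul U.unop a b
  d_map {U V} f a := D.d_map f.unop a
  d_app {U} a := D.d_const U.unop a

/-- The morphism `Ω_{X/k} ⟶ M` induced by a derivation with values in `M`. -/
def Deriv.desc {M : X.left.Modules} (D : Deriv X M) : omegaSheaf X ⟶ M :=
  ((PresheafOfModules.sheafificationAdjunction (𝟙 X.left.ringCatSheaf.obj)).homEquiv (preOmega X) M).symm
    ((PresheafOfModules.DifferentialsConstruction.isUniversal' (structMap X)).desc D.toDerivation')

theorem Deriv.desc_d {M : X.left.Modules} (D : Deriv X M) (U : X.left.Opens) (a : Γ(X.left, U)) :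
    D.desc.app U ((univDeriv X).d U a) = D.d U a := by
  have h1 := ((PresheafOfModules.sheafificationAdjunction (𝟙 X.left.ringCatSheaf.obj)).homEquiv
    (preOmega X) M).apply_symm_apply
    ((PresheafOfModules.DifferentialsConstruction.isUniversal' (structMap X)).desc D.toDerivation')
  replace h1 := (Adjunction.homEquiv_unit
    (adj := PresheafOfModules.sheafificationAdjunction (𝟙 X.left.ringCatSheaf.obj))
    (X := preOmega X) (Y := M) (f := D.desc)).symm.trans h1
  have h2 := (PresheafOfModules.DifferentialsConstruction.isUniversal' (structMap X)).fac
    D.toDerivation'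
  rw [← h1] at h2
  exact PresheafOfModules.Derivation.congr_d h2 (X := op U) a

theorem omega_hom_ext {M : X.left.Modules} (α β : omegaSheaf X ⟶ M)
    (h : ∀ U (a : Γ(X.left, U)),
      α.app U ((univDeriv X).d U a) = β.app U ((univDeriv X).d U a)) : α = β := by
  apply ((PresheafOfModules.sheafificationAdjunction (𝟙 X.left.ringCatSheaf.obj)).homEquiv
    (preOmega X) M).injective
  refine (Adjunction.homEquiv_unit ..).trans (Eq.trans ?_ (Adjunction.homEquiv_unit ..).symm)
  apply (PresheafOfModules.DifferentialsConstruction.isUniversal' (structMap X)).postcomp_injective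
  ext U a
  exact h U.unop a

/-- For a morphism `f : X ⟶ Y` of `k`-schemes, the derivation `b ↦ d(f^♯ b)` of `𝒪_Y` with values
in `f_* Ω_{X/k}`. -/
def pushDeriv (f : X ⟶ Y) : Deriv Y ((Scheme.Modules.pushforward f.left).obj (omegaSheaf X)) where
  d U := ((univDeriv X).d (f.left ⁻¹ᵁ U)).comp (f.left.app U).hom.toAddMonoidHom
  d_mul U a b := by
    have := (univDeriv X).d_mul (f.left ⁻¹ᵁ U) (f.left.app U a) (f.left.app U b)
    rw [← map_mul] at this
    exact this
  d_map {U V} i a := by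
    have := (univDeriv X).d_map ((TopologicalSpace.Opens.map f.left.base).map i) (f.left.app V a)
    refine Eq.trans ?_ this
    have h := congr($(f.left.naturality i.op) a)
    exact congrArg ((univDeriv X).d (f.left ⁻¹ᵁ U)) h
  d_const U c := by
    refine Eq.trans ?_ ((univDeriv X).d_const (f.left ⁻¹ᵁ U) c)
    have h : (structMap Y).app (op U) ≫ f.left.app U = (structMap X).app (op (f.left ⁻¹ᵁ U)) := by
      have hw : f.left ≫ Y.hom = X.hom := Over.w f
      have : X.hom.appLE ⊤ (f.left ⁻¹ᵁ U) (by simp) =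
          Y.hom.appLE ⊤ U (by simp) ≫ f.left.app U := by
        rw [Scheme.Hom.app_eq_appLE]
        refine Eq.trans ?_ (Scheme.Hom.appLE_comp_appLE f.left Y.hom _ _ _ _ _).symm
        simp only [hw]
      simp only [structMap, Category.assoc]
      rw [this]
    exact congrArg ((univDeriv X).d (f.left ⁻¹ᵁ U)) congr($h c)

/-- The canonical map `Ω_{Y/k} ⟶ f_* Ω_{X/k}`, `db ↦ d(f^♯ b)` (the adjoint of
`f^* Ω_{Y/k} ⟶ Ω_{X/k}`). -/
def omegaMap (f : X ⟶ Y) : omegaSheaf Y ⟶ (Scheme.Modules.pushforward f.left).obj (omegaSheaf X) :=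
  (pushDeriv f).desc

theorem omegaMap_d (f : X ⟶ Y) (U : Y.left.Opens) (a : Γ(Y.left, U)) :
    (omegaMap f).app U ((univDeriv Y).d U a) =
      (univDeriv X).d (f.left ⁻¹ᵁ U) (f.left.app U a) :=
  (pushDeriv f).desc_d U a

/-! ### The category of quasi-coherent sheaves over varying `k`-schemes -/

/-- Pairs consisting of a `k`-scheme and a sheaf of modules on it. -/
structure ModOver (k : Type u) [Field k] where
  base : Over (Spec (.of k))
  sheaf : base.left.Modules

/-- A morphism `(X, M) ⟶ (Y, N)` is a morphism `f : X ⟶ Y` of `k`-schemes with an `𝒪_Y`-linear map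
`N ⟶ f_* M` (equivalently `f^* N ⟶ M`). -/
structure ModOver.Hom (E F : ModOver k) where
  base : E.base ⟶ F.base
  map : F.sheaf ⟶ (Scheme.Modules.pushforward base.left).obj E.sheaf

theorem ModOver.Hom.ext_app {E F : ModOver k} {f g : ModOver.Hom E F} (h : f.base = g.base)
    (h' : ∀ U (s : Γ(F.sheaf, U)), E.sheaf.presheaf.map (eqToHom (by rw [h])).op (f.map.app U s) =
      g.map.app U s) : f = g := by
  obtain ⟨f, α⟩ := f
  obtain ⟨g, β⟩ := g
  obtain rfl : f = g := h
  congr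
  ext U s
  refine Eq.trans ?_ (h' U s)
  exact congr($(E.sheaf.presheaf.map_id _) (α.app U s)).symm

instance : Category (ModOver k) where
  Hom := ModOver.Hom
  id E := ⟨𝟙 _, (Scheme.Modules.pushforwardId _).inv.app E.sheaf⟩
  comp f g := ⟨f.base ≫ g.base, g.map ≫ (Scheme.Modules.pushforward g.base.left).map f.map ≫
    (Scheme.Modules.pushforwardComp f.base.left g.base.left).hom.app _⟩
  id_comp {E F} f := ModOver.Hom.ext_app (Category.id_comp _) fun U s =>
    congr($(E.sheaf.presheaf.map_id _) (f.map.app U s))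
  comp_id {E F} f := ModOver.Hom.ext_app (Category.comp_id _) fun U s =>
    congr($(E.sheaf.presheaf.map_id _) (f.map.app U s))
  assoc {E F G H} f g h := ModOver.Hom.ext_app (Category.assoc _ _ _) fun U s =>
    congr($(E.sheaf.presheaf.map_id _) (f.map.app _ (g.map.app _ (h.map.app U s))))

/-- The sheaf of the pair is quasi-coherent. -/
def isQCoh (k : Type u) [Field k] : ObjectProperty (ModOver k) :=
  fun E => E.sheaf.IsQuasicoherent

/-- The category of pairs `(X, M)` with `X` a `k`-scheme and `M` a quasi-coherent sheaf on `X`. -/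
abbrev QCoh (k : Type u) [Field k] := (isQCoh k).FullSubcategory

attribute [local irreducible] omegaSheaf univDeriv omegaMap

theorem omegaMap_id (X : Over (Spec (.of k))) :
    omegaMap (𝟙 X) = (Scheme.Modules.pushforwardId _).inv.app (omegaSheaf X) := by
  apply omega_hom_ext
  intro U a
  exact omegaMap_d (𝟙 X) U a

theorem omegaMap_comp {X Y Z : Over (Spec (.of k))} (f : X ⟶ Y) (g : Y ⟶ Z) :
    omegaMap (f ≫ g) = omegaMap g ≫ (Scheme.Modules.pushforward g.left).map (omegaMap f) ≫
      (Scheme.Modules.pushforwardComp f.left g.left).hom.app (omegaSheaf X) := by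
  apply omega_hom_ext
  intro U a
  have h1 := omegaMap_d g U a
  have h2 := omegaMap_d f (g.left ⁻¹ᵁ U) (g.left.app U a)
  rw [← h1] at h2
  have h3 := omegaMap_d (f ≫ g) U a
  rw [h3]
  exact h2.symm

/-- The functor `X ↦ (X, Ω_{X/k})`. -/
def omega (k : Type u) [Field k] : Over (Spec (.of k)) ⥤ ModOver k where
  obj X := ⟨X, omegaSheaf X⟩
  map f := ⟨f, omegaMap f⟩
  map_id X := 
    congrArg (ModOver.Hom.mk (E := ⟨X, omegaSheaf X⟩) (F := ⟨X, omegaSheaf X⟩) (𝟙 X))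
      (omegaMap_id X)
  map_comp {X Y Z} f g :=
    congrArg (ModOver.Hom.mk (E := ⟨X, omegaSheaf X⟩) (F := ⟨Z, omegaSheaf Z⟩) (f ≫ g))
      (omegaMap_comp f g)

/-! ### Artinian local `k`-algebras and deformations of schemes -/

/-- Artinian local `k`-algebras with residue field `k`. -/
def isArt (k : Type u) [Field k] : ObjectProperty (CommAlgCat.{u} k) := fun A =>
  IsArtinianRing A ∧ ∃ _ : IsLocalRing A,
    Function.Bijective (algebraMap k (IsLocalRing.ResidueField A))

/-- The category of Artinian local `k`-algebras with residue field `k`; its morphisms are the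
`k`-algebra homomorphisms (which are automatically local). -/
abbrev Art (k : Type u) [Field k] := (isArt k).FullSubcategory

namespace Art
instance (A : Art k) : IsLocalRing A.obj := A.property.2.choose

/-- The residue map `A → k`. -/
def aug (A : Art k) : A.obj →ₐ[k] k :=
  ((AlgEquiv.ofBijective (Algebra.ofId k (IsLocalRing.ResidueField A.obj))
    A.property.2.choose_spec).symm : IsLocalRing.ResidueField A.obj →ₐ[k] k).comp
    (IsScalarTower.toAlgHom k A.obj (IsLocalRing.ResidueField A.obj))

theorem algHom_unique (A : Art k) (f g : A.obj →ₐ[k] k) : f = g := by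
  have hf (h : A.obj →ₐ[k] k) : RingHom.ker h = IsLocalRing.maximalIdeal A.obj := by
    have : Function.Surjective h := fun c => ⟨algebraMap k _ c, by simp⟩
    exact IsLocalRing.eq_maximalIdeal (RingHom.ker_isMaximal_of_surjective h this)
  ext a
  have h1 : a - algebraMap k _ (f a) ∈ RingHom.ker f := by simp [RingHom.mem_ker]
  rw [hf f, ← hf g, RingHom.mem_ker] at h1
  rw [map_sub, AlgHom.commutes, sub_eq_zero] at h1
  exact h1.symm

/-- The scheme `Spec A`. -/
abbrev spec (A : Art k) : Scheme.{u} := Spec (.of A.obj)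

/-- The morphism `Spec A ⟶ Spec B` of `f : B ⟶ A`. -/
def specMap {B A : Art k} (f : B ⟶ A) : A.spec ⟶ B.spec :=
  Spec.map (CommRingCat.ofHom f.hom.hom.toRingHom)

/-- The closed point `Spec k ⟶ Spec A`. -/
def point (A : Art k) : Spec (.of k) ⟶ A.spec := Spec.map (CommRingCat.ofHom A.aug.toRingHom)

/-- The structure morphism `Spec A ⟶ Spec k`. -/
def toField (A : Art k) : A.spec ⟶ Spec (.of k) :=
  Spec.map (CommRingCat.ofHom (algebraMap k A.obj))

theorem point_toField (A : Art k) : A.point ≫ A.toField = 𝟙 _ := by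
  rw [point, toField, ← Spec.map_comp, ← CommRingCat.ofHom_comp, ← Spec.map_id]
  congr 1
  ext x
  simp

theorem specMap_toField {B A : Art k} (f : B ⟶ A) : specMap f ≫ B.toField = A.toField := by
  rw [specMap, toField, toField, ← Spec.map_comp, ← CommRingCat.ofHom_comp]
  congr 1
  ext x
  simp

theorem point_specMap {B A : Art k} (f : B ⟶ A) : A.point ≫ specMap f = B.point := by
  rw [specMap, point, point, ← Spec.map_comp, ← CommRingCat.ofHom_comp]
  have := B.algHom_unique (A.aug.comp f.hom.hom) B.aug
  congr 2
  exact congrArg AlgHom.toRingHom this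

theorem specMap_id (A : Art k) : specMap (𝟙 A) = 𝟙 _ := Spec.map_id _
theorem specMap_comp {C B A : Art k} (f : C ⟶ B) (g : B ⟶ A) :
    specMap (f ≫ g) = specMap g ≫ specMap f := by
  rw [specMap, specMap, specMap, ← Spec.map_comp, ← CommRingCat.ofHom_comp]
  rfl

theorem isClosedImmersion_point (A : Art k) : IsClosedImmersion A.point :=
  IsClosedImmersion.spec_of_surjective _ fun c => ⟨algebraMap k A.obj c, by simp⟩
end Art

/-- An (infinitesimal) deformation of the `k`-scheme `X` over `A`: a flat `A`-scheme `total` with a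
closed immersion `i` of `X` which identifies `X` with the closed fibre. -/
structure Deformation (X : Over (Spec (.of k))) (A : Art k) where
  total : Scheme.{u}
  π : total ⟶ A.spec
  i : X.left ⟶ total
  flat : Flat π
  closed : IsClosedImmersion i
  isPullback : IsPullback i X.hom π A.point

namespace Deformation
variable {X : Over (Spec (.of k))} {A B C : Art k}

/-- The total space of a deformation, as a `k`-scheme. -/
abbrev toOver (D : Deformation X A) : Over (Spec (.of k)) := Over.mk (D.π ≫ A.toField)

/-- Isomorphisms of deformations: isomorphisms over `A` that are the identity on `X`. -/
structure Iso (D D' : Deformation X A) where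
  e : D.total ≅ D'.total
  π : e.hom ≫ D'.π = D.π
  i : D.i ≫ e.hom = D'.i

instance setoid (X : Over (Spec (.of k))) (A : Art k) : Setoid (Deformation X A) where
  r D D' := Nonempty (Iso D D')
  iseqv :=
    { refl D := ⟨⟨.refl _, by simp, by simp⟩⟩
      symm := fun ⟨φ⟩ => ⟨⟨φ.e.symm, by simp [← φ.π], by simp [← φ.i]⟩⟩
      trans := fun ⟨φ⟩ ⟨ψ⟩ => ⟨⟨φ.e ≪≫ ψ.e, by simp [φ.π, ψ.π], by simp [reassoc_of% φ.i, ψ.i]⟩⟩ }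

/-- The inclusion of `X` in the base change of a deformation. -/
def baseChangeι (f : B ⟶ A) (D : Deformation X B) :
    X.left ⟶ Limits.pullback D.π (Art.specMap f) :=
  Limits.pullback.lift D.i (X.hom ≫ A.point)
    (by rw [D.isPullback.w, Category.assoc, Art.point_specMap])

theorem baseChangeι_fst (f : B ⟶ A) (D : Deformation X B) :
    D.baseChangeι f ≫ Limits.pullback.fst D.π (Art.specMap f) = D.i :=
  Limits.pullback.lift_fst ..

theorem baseChangeι_snd (f : B ⟶ A) (D : Deformation X B) :
    D.baseChangeι f ≫ Limits.pullback.snd D.π (Art.specMap f) = X.hom ≫ A.point :=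
  Limits.pullback.lift_snd ..

theorem baseChange_isPullback (f : B ⟶ A) (D : Deformation X B) :
    IsPullback (D.baseChangeι f) X.hom (Limits.pullback.snd D.π (Art.specMap f)) A.point := by
  refine IsPullback.of_right ?_ (D.baseChangeι_snd f)
    (IsPullback.of_hasPullback D.π (Art.specMap f))
  rw [baseChangeι_fst, Art.point_specMap]
  exact D.isPullback

/-- The base change of a deformation along `f : B ⟶ A`. -/
def baseChange (f : B ⟶ A) (D : Deformation X B) : Deformation X A where
  total := Limits.pullback D.π (Art.specMap f)
  π := Limits.pullback.snd _ _
  i := D.baseChangeι f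
  flat := MorphismProperty.of_isPullback (P := @Flat)
    (IsPullback.of_hasPullback D.π (Art.specMap f)) D.flat
  closed := MorphismProperty.of_isPullback (D.baseChange_isPullback f).flip
    A.isClosedImmersion_point
  isPullback := D.baseChange_isPullback f

/-- The projection from the base change to the original total space. -/
def baseChangeFst (f : B ⟶ A) (D : Deformation X B) : (D.baseChange f).total ⟶ D.total :=
  Limits.pullback.fst D.π (Art.specMap f)

theorem baseChangeFst_isPullback (f : B ⟶ A) (D : Deformation X B) :
    IsPullback (D.baseChangeFst f) (D.baseChange f).π D.π (Art.specMap f) :=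
  IsPullback.of_hasPullback D.π (Art.specMap f)

theorem i_baseChangeFst (f : B ⟶ A) (D : Deformation X B) :
    (D.baseChange f).i ≫ D.baseChangeFst f = D.i :=
  D.baseChangeι_fst f

theorem baseChange_equiv (f : B ⟶ A) (D : Deformation X B) (E : Deformation X A)
    (g : E.total ⟶ D.total) (h : IsPullback g E.π D.π (Art.specMap f)) (hi : E.i ≫ g = D.i) :
    D.baseChange f ≈ E := by
  refine ⟨⟨(D.baseChangeFst_isPullback f).isoIsPullback _ _ h,
    IsPullback.isoIsPullback_hom_snd .., ?_⟩⟩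
  apply h.hom_ext
  · rw [Category.assoc, IsPullback.isoIsPullback_hom_fst, hi, i_baseChangeFst]
  · rw [Category.assoc, IsPullback.isoIsPullback_hom_snd, E.isPullback.w,
      (D.baseChange f).isPullback.w]

theorem baseChange_congr (f : B ⟶ A) {D D' : Deformation X B} (h : D ≈ D') :
    D.baseChange f ≈ D'.baseChange f := by
  obtain ⟨φ⟩ := h
  refine baseChange_equiv f D (D'.baseChange f) (D'.baseChangeFst f ≫ φ.e.inv) ?_ ?_
  · refine IsPullback.of_iso (D'.baseChangeFst_isPullback f) (.refl _) φ.e.symm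
      (.refl _) (.refl _) ?_ ?_ ?_ ?_ <;> simp [← φ.π]
  · rw [← Category.assoc, i_baseChangeFst, ← φ.i]
    simp

theorem baseChange_id (D : Deformation X A) : D.baseChange (𝟙 A) ≈ D := by
  refine baseChange_equiv _ D D (𝟙 _) ?_ (by simp)
  rw [Art.specMap_id]
  exact IsPullback.of_id_fst

theorem baseChange_comp (f : C ⟶ B) (g : B ⟶ A) (D : Deformation X C) :
    D.baseChange (f ≫ g) ≈ (D.baseChange f).baseChange g := by
  refine baseChange_equiv _ D ((D.baseChange f).baseChange g)
    ((D.baseChange f).baseChangeFst g ≫ D.baseChangeFst f) ?_ ?_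
  · rw [Art.specMap_comp]
    exact ((D.baseChange f).baseChangeFst_isPullback g).paste_horiz (D.baseChangeFst_isPullback f)
  · rw [← Category.assoc, i_baseChangeFst, i_baseChangeFst]

end Deformation

/-- The deformation functor `D_X`: isomorphism classes of deformations of `X`, with base change. -/
def defFunctor (X : Over (Spec (.of k))) : Art k ⥤ Type (u + 1) where
  obj A := Quotient (Deformation.setoid X A)
  map f := TypeCat.ofHom (Quotient.map (Deformation.baseChange f)
    fun _ _ => Deformation.baseChange_congr f)
  map_id A := by
    ext ⟨D⟩
    exact Quotient.sound D.baseChange_id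
  map_comp {A B C} f g := by
    ext ⟨D⟩
    exact Quotient.sound (D.baseChange_comp f g)


/-! ### Fibered deformations -/

/-- An isomorphism of sheaves on a fixed `k`-scheme, seen in `ModOver k`. -/
def ModOver.fiberIso (X : Over (Spec (.of k))) {M N : X.left.Modules} (e : M ≅ N) :
    ModOver.mk X M ≅ ModOver.mk X N where
  hom := ⟨𝟙 X, e.inv ≫ (Scheme.Modules.pushforwardId _).inv.app M⟩
  inv := ⟨𝟙 X, e.hom ≫ (Scheme.Modules.pushforwardId _).inv.app N⟩
  hom_inv_id := ModOver.Hom.ext_app (Category.comp_id _) fun U s =>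
    congr($(M.presheaf.map_id _) ((e.hom ≫ e.inv).app U s)).trans (by rw [e.hom_inv_id]; rfl)
  inv_hom_id := ModOver.Hom.ext_app (Category.comp_id _) fun U s =>
    congr($(N.presheaf.map_id _) ((e.inv ≫ e.hom).app U s)).trans (by rw [e.inv_hom_id]; rfl)

/-- A fibered deformation of `X` over `A`: a pair `(𝒳, Ω_{𝒳/k})` with `𝒳` a deformation of `X`
over `A`. The second member is a sheaf on `𝒳` that is isomorphic to `Ω_{𝒳/k}`. -/
structure FiberedDeformation (X : Over (Spec (.of k))) (A : Art k) where
  deformation : Deformation X A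
  sheaf : deformation.toOver.left.Modules
  isOmega : Nonempty (sheaf ≅ omegaSheaf deformation.toOver)

namespace FiberedDeformation
variable {X : Over (Spec (.of k))} {A B C : Art k}

/-- The pair `(𝒳, sheaf)` as an object of `ModOver k`. -/
def toModOver (E : FiberedDeformation X A) : ModOver k := ⟨E.deformation.toOver, E.sheaf⟩

/-- Isomorphisms of fibered deformations: an isomorphism of the deformations together with an
isomorphism of the pairs `(𝒳, sheaf)` lying over it. -/
structure Iso (E E' : FiberedDeformation X A) where
  φ : Deformation.Iso E.deformation E'.deformation
  ψ : E.toModOver ≅ E'.toModOver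
  compat : ψ.hom.base.left = φ.e.hom

/-- The fibered deformation `(𝒳, Ω_{𝒳/k})` of a deformation `𝒳`. -/
def ofDeformation (D : Deformation X A) : FiberedDeformation X A where
  deformation := D
  sheaf := ((omega k).obj D.toOver).sheaf
  isOmega := ⟨.refl _⟩

theorem nonempty_iso_iff (E E' : FiberedDeformation X A) :
    Nonempty (Iso E E') ↔ E.deformation ≈ E'.deformation := by
  refine ⟨fun ⟨h⟩ => ⟨h.φ⟩, fun ⟨φ⟩ => ?_⟩
  obtain ⟨e⟩ := E.isOmega
  obtain ⟨e'⟩ := E'.isOmega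
  let o : E.deformation.toOver ≅ E'.deformation.toOver :=
    Over.isoMk φ.e (by simp [reassoc_of% φ.π])
  refine ⟨⟨φ, ModOver.fiberIso _ e ≪≫ (omega k).mapIso o ≪≫ (ModOver.fiberIso _ e').symm, ?_⟩⟩
  have : (𝟙 _ ≫ o.hom ≫ 𝟙 _).left = φ.e.hom := by simp [o]
  exact this

instance setoid (X : Over (Spec (.of k))) (A : Art k) : Setoid (FiberedDeformation X A) where
  r E E' := Nonempty (Iso E E')
  iseqv :=
    { refl E := (nonempty_iso_iff E E).2 (Setoid.refl _)
      symm h := (nonempty_iso_iff _ _).2 (Setoid.symm ((nonempty_iso_iff _ _).1 h))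
      trans h h' := (nonempty_iso_iff _ _).2
        (Setoid.trans ((nonempty_iso_iff _ _).1 h) ((nonempty_iso_iff _ _).1 h')) }

/-- A morphism `f : B ⟶ A` takes `(𝒳, Ω_{𝒳/k})` to `(𝒳_A, Ω_{𝒳_A/k})` with `𝒳_A` the base change of
the deformation `𝒳`. -/
def baseChange (f : B ⟶ A) (E : FiberedDeformation X B) : FiberedDeformation X A :=
  ofDeformation (E.deformation.baseChange f)

end FiberedDeformation

/-- The functor of isomorphism classes of fibered deformations of `X`. -/
def fiberedDefFunctor (X : Over (Spec (.of k))) : Art k ⥤ Type (u + 1) where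
  obj A := Quotient (FiberedDeformation.setoid X A)
  map f := TypeCat.ofHom (Quotient.map (FiberedDeformation.baseChange f) fun _ _ h =>
    (FiberedDeformation.nonempty_iso_iff _ _).2
      (Deformation.baseChange_congr f ((FiberedDeformation.nonempty_iso_iff _ _).1 h)))
  map_id A := by
    ext ⟨E⟩
    exact Quotient.sound ((FiberedDeformation.nonempty_iso_iff _ _).2 E.deformation.baseChange_id)
  map_comp {A B C} f g := by
    ext ⟨E⟩
    exact Quotient.sound
      ((FiberedDeformation.nonempty_iso_iff _ _).2 (E.deformation.baseChange_comp f g))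

/-! ### Smoothness -/

/-- Smoothness of a morphism of functors in the sense of Schlessinger: for every surjective
`f : B ⟶ A` the map `F(B) → F(A) ×_{G(A)} G(B)` is surjective. -/
def IsSmoothTrans {F G : Art k ⥤ Type (u + 1)} (θ : F ⟶ G) : Prop :=
  ∀ ⦃B A : Art k⦄ (f : B ⟶ A), Function.Surjective f.hom.hom →
    ∀ (x : F.obj A) (y : G.obj B), θ.app A x = G.map f y →
      ∃ z : F.obj B, F.map f z = x ∧ θ.app B z = y

/-- Smoothness of a functor `F` from `k`-schemes to a category `C`, whose objects `c` have a
deformation functor `Def c`, and where `Fdef` takes a deformation `𝒳` of `X` to the class of its image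
`F(𝒳)` as a deformation of `F(X)`: for every `X` the assignment `𝒳 ↦ F(𝒳)` is a well-defined morphism
of functors `D_X ⟶ D_{F(X)}`, and this morphism is smooth. -/
def IsSmoothFunctor {C : Type*} [Category C] (F : Over (Spec (.of k)) ⥤ C)
    (Def : C → Art k ⥤ Type (u + 1))
    (Fdef : ∀ (X : Over (Spec (.of k))) (A : Art k), Deformation X A → (Def (F.obj X)).obj A) :
    Prop :=
  ∀ X, ∃ θ : defFunctor X ⟶ Def (F.obj X),
    (∀ (A : Art k) (D : Deformation X A), θ.app A (Quotient.mk _ D) = Fdef X A D) ∧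
      IsSmoothTrans θ

end OmegaSmooth

end

open OmegaSmooth

/-!
A localization is formally étale, so a derivation of `R` with values in the global sections of a
sheaf of modules `M` on `Spec R` extends uniquely to the sections of `𝒪` over basic open subsets,
hence to a derivation of `𝒪` with values in `M`. Derivations of `𝒪` over `k` into `M` are
therefore the same as derivations `R → Γ(Spec R, M)` over `k`, and by the adjunction between `(-)^~`
and global sections the sheaf `(Ω_{R/k})^~` carries a universal derivation. Universal derivations
restrict to universal derivations along open immersions, by adjunction with the pushforward, so
`Ω_{X/k}` restricts to `(Ω_{R/k})^~` on every affine open subset `Spec R` of `X`, which proves that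
it is quasi-coherent.

For the smoothness, `Ω` is functorial, so every isomorphism of deformations lifts to an isomorphism
of fibered deformations. Hence `D_X ⟶ D_{Ω_{X/k}}` is even an isomorphism of functors, and every
isomorphism of functors is smooth.
-/

noncomputable section

namespace OmegaSmooth

section FormallyEtale

variable {A R T P : Type*} [CommRing A] [CommRing R] [CommRing T] [Algebra A T] [Algebra R T]
  [AddCommGroup P] [Module A P] [Module R P] [Module T P] [IsScalarTower R T P]

theorem derivation_ext_of_formallyUnramified [Algebra.FormallyUnramified R T]
    {D D' : Derivation A T P} (h : ∀ a, D (algebraMap R T a) = D' (algebraMap R T a)) :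
    D = D' := by
  let E : Derivation R T P :=
    Derivation.mk' { __ := (D - D').toAddMonoidHom
                     map_smul' r t := by simp [Algebra.smul_def, h, smul_sub] }
      (D - D').leibniz
  have hE (t : T) : E t = 0 := by
    rw [← E.liftKaehlerDifferential_comp_D, Subsingleton.elim (KaehlerDifferential.D R T t) 0,
      map_zero]
  exact Derivation.ext fun t => sub_eq_zero.1 (hE t)

variable [Algebra A R] [IsScalarTower A R T] [IsScalarTower A R P] [IsScalarTower A T P]
  [Algebra.FormallyEtale R T]

variable (T) in
/-- The extension of a derivation of `R` with values in a `T`-module to a formally étale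
`R`-algebra `T`. -/
def liftDerivation (D : Derivation A R P) : Derivation A T P :=
  ((KaehlerDifferential.isBaseChange_of_formallyEtale A R T).lift
    D.liftKaehlerDifferential).compDer (KaehlerDifferential.D A T)

theorem liftDerivation_algebraMap (D : Derivation A R P) (a : R) :
    liftDerivation T D (algebraMap R T a) = D a := by
  have := (KaehlerDifferential.isBaseChange_of_formallyEtale A R T).lift_eq
    D.liftKaehlerDifferential (KaehlerDifferential.D A R a)
  rwa [KaehlerDifferential.map_D, Derivation.liftKaehlerDifferential_comp_D] at this

theorem map_liftDerivation {T' P' : Type*} [CommRing T'] [Algebra A T'] [Algebra R T']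
    [IsScalarTower A R T'] [Algebra.FormallyEtale R T'] [Algebra T T'] [IsScalarTower R T T']
    [IsScalarTower A T T'] [AddCommGroup P'] [Module A P'] [Module R P'] [Module T P']
    [Module T' P'] [IsScalarTower A R P'] [IsScalarTower A T P'] [IsScalarTower A T' P']
    [IsScalarTower R T P'] [IsScalarTower R T' P'] [IsScalarTower T T' P']
    (g : P →ₗ[T] P') (D : Derivation A R P) (x : T) :
    g (liftDerivation T D x) =
      liftDerivation T' ((g.restrictScalars R).compDer D) (algebraMap T T' x) := by
  suffices g.compDer (liftDerivation T D) =
      (liftDerivation T' ((g.restrictScalars R).compDer D)).compAlgebraMap T from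
    DFunLike.congr_fun this x
  refine derivation_ext_of_formallyUnramified (R := R) fun a => ?_
  refine (congrArg g (liftDerivation_algebraMap D a)).trans ?_
  refine (liftDerivation_algebraMap (T := T') ((g.restrictScalars R).compDer D) a).symm.trans ?_
  exact congrArg (liftDerivation T' _) (IsScalarTower.algebraMap_apply R T T' a)

end FormallyEtale

section Glue

variable {R : CommRingCat.{u}} {M : (Spec R).Modules}

/-- The basic open subset `D(r)` of `Spec R`, as an open subset of the scheme `Spec R`. -/
def specBasicOpen (r : R) : (Spec R).Opens := PrimeSpectrum.basicOpen r

instance (r : R) : IsLocalization.Away r Γ(Spec R, specBasicOpen r) :=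
  StructureSheaf.IsLocalization.to_basicOpen R r

instance (r : R) : Algebra.FormallyEtale R Γ(Spec R, specBasicOpen r) :=
  Algebra.FormallyEtale.of_isLocalization (Submonoid.powers r)

/-- The derivation `R → Γ(U, M)` obtained from `D : R → Γ(Spec R, M)` by restricting sections. -/
def resDerivation (D : Derivation ℤ R Γ(M, ⊤)) (U : (Spec R).Opens) : Derivation ℤ R Γ(M, U) :=
  LinearMap.compDer (N := Γ(M, U)) { (M.presheaf.map (homOfLE le_top : U ⟶ ⊤).op).hom with
    map_smul' := M.map_smul_Spec _ } D

/-- The extension of a derivation `R → Γ(Spec R, M)` to the localization `Γ(D(r), 𝒪) = R_r`. -/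
def basicDerivation (D : Derivation ℤ R Γ(M, ⊤)) (r : R) :
    Derivation ℤ Γ(Spec R, specBasicOpen r) Γ(M, specBasicOpen r) :=
  liftDerivation Γ(Spec R, specBasicOpen r) (resDerivation D (specBasicOpen r))

theorem basicDerivation_map (D : Derivation ℤ R Γ(M, ⊤)) {r s : R}
    (i : specBasicOpen r ⟶ specBasicOpen s) (a : Γ(Spec R, specBasicOpen s)) :
    basicDerivation D r ((Spec R).presheaf.map i.op a) =
      M.presheaf.map i.op (basicDerivation D s a) := by
  let := ((Spec R).presheaf.map i.op).hom.toAlgebra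
  let := Module.compHom Γ(M, specBasicOpen r) ((Spec R).presheaf.map i.op).hom
  have : IsScalarTower R Γ(Spec R, specBasicOpen s) Γ(Spec R, specBasicOpen r) :=
    .of_algebraMap_eq fun _ => rfl
  have : IsScalarTower R Γ(Spec R, specBasicOpen s) Γ(M, specBasicOpen r) :=
    .of_algebraMap_smul fun _ _ => rfl
  have : IsScalarTower Γ(Spec R, specBasicOpen s) Γ(Spec R, specBasicOpen r)
    Γ(M, specBasicOpen r) := .of_algebraMap_smul fun _ _ => rfl
  let g : Γ(M, specBasicOpen s) →ₗ[Γ(Spec R, specBasicOpen s)] Γ(M, specBasicOpen r) :=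
    { (M.presheaf.map i.op).hom with
      map_smul' a x := M.map_smul i a x }
  have hg : (g.restrictScalars R).compDer (resDerivation D _) = resDerivation D _ :=
    Derivation.ext fun b => congr($(M.presheaf.map_comp (homOfLE le_top).op i.op) (D b)).symm
  exact ((map_liftDerivation g _ a).trans congr(liftDerivation _ $hg _)).symm

theorem isBasis_specBasicOpen :
    TopologicalSpace.Opens.IsBasis (Set.range (specBasicOpen (R := R))) :=
  PrimeSpectrum.isBasis_basic_opens

variable (M) in
/-- The sheaf of abelian groups underlying a sheaf of modules on `Spec R`. -/
abbrev addSheaf : TopCat.Sheaf AddCommGrpCat.{u} (Spec R) := ⟨M.presheaf, M.isSheaf⟩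

variable (R) in
/-- The presheaf of abelian groups underlying the structure sheaf of `Spec R`: derivations are
not linear over `𝒪`, so they are glued as morphisms out of this presheaf. -/
abbrev structurePresheafAb : TopCat.Presheaf AddCommGrpCat.{u} (Spec R) :=
  (Spec R).presheaf ⋙ forget₂ CommRingCat RingCat ⋙ forget₂ RingCat AddCommGrpCat

/-- The derivations `basicDerivation D r` as a morphism of presheaves on the basic open subsets. -/
def basicDerivationHom (D : Derivation ℤ R Γ(M, ⊤)) :
    (inducedFunctor (specBasicOpen (R := R))).op ⋙ structurePresheafAb R ⟶
      (inducedFunctor specBasicOpen).op ⋙ M.presheaf where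
  app r := AddCommGrpCat.ofHom (basicDerivation D r.unop).toAddMonoidHom
  naturality r s i := by
    ext a
    exact basicDerivation_map D i.unop.hom a

/-- The extension of a derivation `R → Γ(Spec R, M)` to the structure sheaf. It is constructed as a
morphism of presheaves of abelian groups; the Leibniz rule is `glueDerivation_mul`. -/
def glueDerivation (D : Derivation ℤ R Γ(M, ⊤)) : structurePresheafAb R ⟶ M.presheaf :=
  TopCat.Sheaf.restrictHomEquivHom _ (addSheaf M) isBasis_specBasicOpen (basicDerivationHom D)

theorem glueDerivation_app (D : Derivation ℤ R Γ(M, ⊤)) (r : R) (a : Γ(Spec R, specBasicOpen r)) :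
    (glueDerivation D).app (op (specBasicOpen r)) a = basicDerivation D r a :=
  ConcreteCategory.congr_hom
    (TopCat.Sheaf.extend_hom_app _ (addSheaf M) isBasis_specBasicOpen (basicDerivationHom D) r) a

theorem section_ext_of_specBasicOpen {U : (Spec R).Opens} {s t : Γ(M, U)}
    (h : ∀ (r : R) (i : specBasicOpen r ⟶ U), M.presheaf.map i.op s = M.presheaf.map i.op t) :
    s = t :=
  TopCat.Presheaf.IsSheaf.section_ext M.isSheaf fun _ hx =>
    let ⟨_, ⟨r, hr⟩, hxr, hrU⟩ := TopologicalSpace.Opens.isBasis_iff_nbhd.1 isBasis_specBasicOpen hx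
    ⟨specBasicOpen r, hr ▸ hrU, hr ▸ hxr, h r (homOfLE (hr ▸ hrU))⟩

theorem glueDerivation_map (D : Derivation ℤ R Γ(M, ⊤)) {r : R} {U : (Spec R).Opens}
    (i : specBasicOpen r ⟶ U) (a : Γ(Spec R, U)) :
    M.presheaf.map i.op ((glueDerivation D).app (op U) a) =
      basicDerivation D r ((Spec R).presheaf.map i.op a) :=
  (ConcreteCategory.congr_hom ((glueDerivation D).naturality i.op) a).symm.trans
    (glueDerivation_app D r _)

theorem glueDerivation_mul (D : Derivation ℤ R Γ(M, ⊤)) (U : (Spec R).Opens) (a b : Γ(Spec R, U)) :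
    (glueDerivation D).app (op U) (a * b) =
      (a • (glueDerivation D).app (op U) b : Γ(M, U)) +
        (b • (glueDerivation D).app (op U) a : Γ(M, U)) := by
  refine section_ext_of_specBasicOpen fun r i => ?_
  simp only [glueDerivation_map, map_mul, map_add, Scheme.Modules.map_smul, Derivation.leibniz]

theorem glueDerivation_top (D : Derivation ℤ R Γ(M, ⊤)) (a : R) :
    (glueDerivation D).app (op ⊤) ((Scheme.ΓSpecIso R).inv a) = D a := by
  refine section_ext_of_specBasicOpen fun r i => ?_
  exact (glueDerivation_map D i _).trans (liftDerivation_algebraMap (resDerivation D _) a)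

end Glue

variable {k : Type u} [Field k]

section Deriv

variable {X Y : Over (Spec (.of k))}

theorem structMap_app_comp_app (f : X ⟶ Y) (U : Y.left.Opens) :
    (structMap Y).app (op U) ≫ f.left.app U = (structMap X).app (op (f.left ⁻¹ᵁ U)) := by
  have h : Y.hom.appLE ⊤ U (by simp) ≫ f.left.app U = X.hom.appLE ⊤ (f.left ⁻¹ᵁ U) (by simp) := by
    have hw : f.left ≫ Y.hom = X.hom := Over.w f
    rw [Scheme.Hom.app_eq_appLE]
    exact (Scheme.Hom.appLE_comp_appLE ..).trans (by simp only [hw])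
  simp only [structMap, Category.assoc, h]

theorem structMap_app_comp_appIso_inv (f : X ⟶ Y) [IsOpenImmersion f.left] (U : X.left.Opens) :
    (structMap X).app (op U) ≫ (f.left.appIso U).inv = (structMap Y).app (op (f.left ''ᵁ U)) := by
  rw [Iso.comp_inv_eq, Scheme.Hom.appIso_hom, ← Category.assoc, structMap_app_comp_app]
  exact (Category.id_comp _).symm.trans
    ((structMap X).naturality (eqToHom (f.left.preimage_image_eq U).symm).op)

@[ext]
theorem Deriv.ext {M : X.left.Modules} {D D' : Deriv X M} (h : ∀ U a, D.d U a = D'.d U a) :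
    D = D' := by
  obtain ⟨d, _, _, _⟩ := D
  obtain ⟨d', _, _, _⟩ := D'
  obtain rfl : d = d' := funext fun U => AddMonoidHom.ext (h U)
  rfl

/-- The composition of a derivation with a morphism of sheaves of modules. -/
def Deriv.comp {M N : X.left.Modules} (D : Deriv X M) (α : M ⟶ N) : Deriv X N where
  d U := (α.app U).hom.comp (D.d U)
  d_mul U a b := by
    refine (congrArg (α.app U) (D.d_mul U a b)).trans ?_
    rw [map_add, Scheme.Modules.Hom.app_smul, Scheme.Modules.Hom.app_smul]
    rfl
  d_map {U V} i a := (congrArg (α.app U) (D.d_map i a)).trans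
    congr($(α.mapPresheaf.naturality i.op) (D.d V a))
  d_const U c := (congrArg (α.app U) (D.d_const U c)).trans (map_zero _)

/-- The derivation of `𝒪_Y` with values in `f_* M` induced by a derivation of `𝒪_X` with values
in `M`. -/
def Deriv.push (f : X ⟶ Y) {M : X.left.Modules} (D : Deriv X M) :
    Deriv Y ((Scheme.Modules.pushforward f.left).obj M) where
  d U := (D.d (f.left ⁻¹ᵁ U)).comp (f.left.app U).hom.toAddMonoidHom
  d_mul U a b := (congrArg (D.d _) (map_mul (f.left.app U).hom a b)).trans (D.d_mul _ _ _)
  d_map {_ V} i a := (congrArg (D.d _) congr($(f.left.naturality i.op) a)).trans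
    (D.d_map ((TopologicalSpace.Opens.map f.left.base).map i) (f.left.app V a))
  d_const U c := (congrArg (D.d _) congr($(structMap_app_comp_app f U) c)).trans (D.d_const _ c)

/-- The restriction of a derivation along an open immersion. -/
def Deriv.restrict (f : X ⟶ Y) [IsOpenImmersion f.left] {M : Y.left.Modules} (D : Deriv Y M) :
    Deriv X (M.restrict f.left) where
  d U := (D.d (f.left ''ᵁ U)).comp (f.left.appIso U).inv.hom.toAddMonoidHom
  d_mul U a b := (congrArg (D.d _) (map_mul (f.left.appIso U).inv.hom a b)).trans (D.d_mul _ _ _)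
  d_map {_ V} i a :=
    (congrArg (D.d _) congr($(Scheme.Hom.appIso_inv_naturality f.left i.op) a)).trans
      (D.d_map (f.left.opensFunctor.map i) ((f.left.appIso V).inv a))
  d_const U c :=
    (congrArg (D.d _) congr($(structMap_app_comp_appIso_inv f U) c)).trans (D.d_const _ c)

theorem Deriv.push_injective (f : X ⟶ Y) [IsOpenImmersion f.left] {M : X.left.Modules} :
    Function.Injective (Deriv.push f (M := M)) := by
  intro D D' h
  have key (E : Deriv X M) (U : X.left.Opens) (a : Γ(X.left, U)) :
      M.presheaf.map (eqToHom (f.left.preimage_image_eq U).symm).op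
        ((E.push f).d (f.left ''ᵁ U) ((f.left.appIso U).inv a)) = E.d U a :=
    (E.d_map _ _).symm.trans (congrArg (E.d U) congr($(f.left.appIso_inv_app_presheafMap U) a))
  ext U a
  rw [← key D, h, key D']

theorem Deriv.comp_restrictAdjunction_homEquiv (f : X ⟶ Y) [IsOpenImmersion f.left]
    {M : Y.left.Modules} {N : X.left.Modules} (D : Deriv Y M) (α : M.restrict f.left ⟶ N) :
    D.comp ((Scheme.Modules.restrictAdjunction f.left).homEquiv M N α) =
      ((D.restrict f).comp α).push f := by
  ext U a
  rw [Adjunction.homEquiv_unit]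
  have unit_app_d : ((Scheme.Modules.restrictAdjunction f.left).unit.app M).app U (D.d U a) =
      (D.restrict f).d (f.left ⁻¹ᵁ U) (f.left.app U a) := by
    rw [Scheme.Modules.restrictAdjunction_unit_app_app]
    exact (D.d_map (homOfLE (f.left.image_preimage_le U)) a).symm.trans
      (congrArg (D.d _) congr($(f.left.app_appIso_inv U) a).symm)
  exact congrArg (α.app (f.left ⁻¹ᵁ U)) unit_app_d

/-- A derivation is universal if every derivation factors uniquely through it, that is, if its
target is a sheaf of differentials. -/
def Deriv.IsUniversal {M : X.left.Modules} (D : Deriv X M) : Prop :=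
  ∀ ⦃N : X.left.Modules⦄ (D' : Deriv X N), ∃! α : M ⟶ N, D.comp α = D'

theorem isUniversal_univDeriv (X : Over (Spec (.of k))) : (univDeriv X).IsUniversal := fun _ D =>
  ⟨D.desc, Deriv.ext D.desc_d, fun α h =>
    omega_hom_ext α D.desc fun U a => congr(($h).d U a).trans (D.desc_d U a).symm⟩

theorem Deriv.IsUniversal.restrict {M : Y.left.Modules} {D : Deriv Y M} (hD : D.IsUniversal)
    (f : X ⟶ Y) [IsOpenImmersion f.left] : (D.restrict f).IsUniversal := by
  intro N D'
  have := (((Scheme.Modules.restrictAdjunction f.left).homEquiv M N).bijective.existsUnique_iff).1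
    (hD (D'.push f))
  simpa only [comp_restrictAdjunction_homEquiv, (push_injective f).eq_iff] using this

theorem Deriv.IsUniversal.hom_ext {M N : X.left.Modules} {D : Deriv X M} (hD : D.IsUniversal)
    {α β : M ⟶ N} (h : D.comp α = D.comp β) : α = β :=
  (hD (D.comp β)).unique h rfl

theorem Deriv.IsUniversal.nonempty_iso {M N : X.left.Modules} {D : Deriv X M} {D' : Deriv X N}
    (hD : D.IsUniversal) (hD' : D'.IsUniversal) : Nonempty (M ≅ N) := by
  obtain ⟨α, hα, -⟩ := hD D'
  obtain ⟨β, hβ, -⟩ := hD' D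
  exact ⟨α, β, hD.hom_ext ((congrArg (·.comp β) hα).trans hβ),
    hD'.hom_ext ((congrArg (·.comp α) hβ).trans hα)⟩

end Deriv

section Affine

variable {R : CommRingCat.{u}} (φ : CommRingCat.of k ⟶ R)

/-- The spectrum of a `k`-algebra, as a `k`-scheme. -/
abbrev specOver : Over (Spec (.of k)) := Over.mk (Spec.map φ)

theorem structMap_specOver_app_top :
    (structMap (specOver φ)).app (op ⊤) = φ ≫ (Scheme.ΓSpecIso R).inv := by
  rw [Scheme.ΓSpecIso_inv_naturality]
  simp only [structMap]
  congr 1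

variable {φ} {M : (Spec R).Modules}

/-- The derivation `R → Γ(Spec R, M)` given by a derivation of the structure sheaf. -/
def Deriv.globalSections (D : Deriv (specOver φ) M) :
    (moduleSpecΓFunctor (R := R).obj M).Derivation φ :=
  ModuleCat.Derivation.mk (fun r => D.d ⊤ ((Scheme.ΓSpecIso R).inv r))
    (fun a b => (congrArg (D.d ⊤) (map_add _ a b)).trans (map_add _ _ _))
    (fun a b => (congrArg (D.d ⊤) (map_mul _ a b)).trans (D.d_mul _ _ _))
    (fun c => (congrArg (D.d ⊤) congr($(structMap_specOver_app_top φ) c)).symm.trans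
      (D.d_const ⊤ c))

theorem Deriv.ext_of_globalSections {D D' : Deriv (specOver φ) M}
    (h : ∀ r, D.globalSections.d r = D'.globalSections.d r) : D = D' := by
  ext U a
  refine section_ext_of_specBasicOpen (M := M) fun r i => ?_
  rw [← D.d_map, ← D'.d_map]
  let toDer (E : Deriv (specOver φ) M) :
      Derivation ℤ Γ(Spec R, specBasicOpen r) Γ(M, specBasicOpen r) :=
    Derivation.mk' (E.d (specBasicOpen r)).toIntLinearMap (E.d_mul _)
  have key (E : Deriv (specOver φ) M) (b : R) : toDer E (algebraMap R _ b) =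
      M.presheaf.map (homOfLE le_top).op (E.globalSections.d b) :=
    E.d_map (homOfLE le_top : specBasicOpen r ⟶ ⊤) ((Scheme.ΓSpecIso R).inv b)
  have hder : toDer D = toDer D' := derivation_ext_of_formallyUnramified (R := R) fun b => by
    rw [key, key, h]
  exact congr($hder _)

/-- The derivation of the structure sheaf of `Spec R` extending a derivation `R → Γ(Spec R, M)`. -/
def Deriv.ofGlobalSections (d : (moduleSpecΓFunctor (R := R).obj M).Derivation φ) :
    Deriv (specOver φ) M :=
  let D : Derivation ℤ R Γ(M, ⊤) :=
    Derivation.mk' (AddMonoidHom.mk' d.d d.d_add).toIntLinearMap d.d_mul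
  { d U := ((glueDerivation D).app (op U)).hom
    d_mul := glueDerivation_mul D
    d_map i a := ConcreteCategory.congr_hom ((glueDerivation D).naturality i.op) a
    d_const U c := by
      have h : (structMap (specOver φ)).app (op U) c =
          (Spec R).presheaf.map (homOfLE le_top : U ⟶ ⊤).op ((Scheme.ΓSpecIso R).inv (φ c)) := by
        have := (structMap (specOver φ)).naturality (homOfLE le_top : U ⟶ ⊤).op
        rw [structMap_specOver_app_top] at this
        exact congr($this c)
      rw [h]
      exact (ConcreteCategory.congr_hom
        ((glueDerivation D).naturality (homOfLE le_top : U ⟶ ⊤).op) _).trans <|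
        (congrArg (M.presheaf.map _) ((glueDerivation_top D _).trans (d.d_map c))).trans
          (map_zero _) }

theorem Deriv.globalSections_ofGlobalSections_d
    (d : (moduleSpecΓFunctor (R := R).obj M).Derivation φ) (r : R) :
    (ofGlobalSections d).globalSections.d r = d.d r :=
  glueDerivation_top _ r

/-- The composition of a derivation of `R` over `k` with a linear map. -/
def postcompDerivation {N N' : ModuleCat.{u} R} (d : N.Derivation φ) (g : N ⟶ N') :
    N'.Derivation φ :=
  .mk (fun r => g (d.d r)) (d_map := fun c => by rw [d.d_map, map_zero])

variable (φ)

/-- The canonical derivation of the structure sheaf of `Spec R` with values in `(Ω_{R/k})^~`. -/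
def tildeDeriv : Deriv (specOver φ) (tilde (CommRingCat.KaehlerDifferential φ)) :=
  .ofGlobalSections <|
    postcompDerivation (CommRingCat.KaehlerDifferential.D φ) (tilde.adjunction.unit.app _)

variable {φ}

theorem globalSections_comp_tildeDeriv_d (α : tilde (CommRingCat.KaehlerDifferential φ) ⟶ M)
    (r : R) :
    ((tildeDeriv φ).comp α).globalSections.d r =
      tilde.adjunction.homEquiv (CommRingCat.KaehlerDifferential φ) M α
        (CommRingCat.KaehlerDifferential.d r) :=
  congrArg (α.app ⊤) (Deriv.globalSections_ofGlobalSections_d _ r)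

theorem comp_tildeDeriv_eq_iff (α : tilde (CommRingCat.KaehlerDifferential φ) ⟶ M)
    (D : Deriv (specOver φ) M) :
    (tildeDeriv φ).comp α = D ↔
      tilde.adjunction.homEquiv (CommRingCat.KaehlerDifferential φ) M α =
        D.globalSections.desc := by
  refine ⟨fun h => CommRingCat.KaehlerDifferential.ext fun r => ?_, fun h =>
    Deriv.ext_of_globalSections fun r => ?_⟩
  · rw [← globalSections_comp_tildeDeriv_d, h, D.globalSections.desc_d]
  · rw [globalSections_comp_tildeDeriv_d, h, D.globalSections.desc_d]

theorem isUniversal_tildeDeriv : (tildeDeriv φ).IsUniversal := by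
  intro N D
  simp only [comp_tildeDeriv_eq_iff]
  exact (tilde.adjunction.homEquiv _ N).bijective.existsUnique _

theorem isQuasicoherent_restrict_omegaSheaf {X : Over (Spec (.of k))} (f : specOver φ ⟶ X)
    [IsOpenImmersion f.left] : ((omegaSheaf X).restrict f.left).IsQuasicoherent := by
  obtain ⟨e⟩ :=
    (isUniversal_tildeDeriv (φ := φ)).nonempty_iso ((isUniversal_univDeriv X).restrict f)
  exact (SheafOfModules.isQuasicoherent.{u} (Spec R).ringCatSheaf).prop_of_iso e inferInstance

end Affine

section Quasicoherence

/-- The presentation over the slice site of `U` given by one over the open subscheme `U`. -/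
def presentationOver {X : Scheme.{u}} (M : X.Modules) (U : X.Opens)
    (P : (M.restrict U.ι).Presentation) : (SheafOfModules.over M U).Presentation :=
  let E := Scheme.Modules.overEquiv U
  let F : SheafOfModules.{u} U.toScheme.ringCatSheaf ⥤ SheafOfModules.{u} (X.ringCatSheaf.over U) :=
    E.inverse
  let e : F.obj (M.restrict U.ι) ≅ SheafOfModules.over M U :=
    E.inverse.mapIso ((Scheme.Modules.overFunctorEquiv U).symm.app M) ≪≫ (E.unitIso.app _).symm
  have : Limits.PreservesColimitsOfSize.{u, u} F :=
    E.symm.toAdjunction.leftAdjoint_preservesColimits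
  (P.map F (E.unitIso.app (SheafOfModules.unit.{u} (X.ringCatSheaf.over U)))).ofIsIso e.hom

theorem isQuasicoherent_of_isOpenCover {X : Scheme.{u}} (M : X.Modules) {ι : Type u}
    {U : ι → X.Opens} (hU : TopologicalSpace.IsOpenCover U)
    (h : ∀ i, Nonempty (M.restrict (U i).ι).Presentation) : M.IsQuasicoherent :=
  SheafOfModules.QuasicoherentData.isQuasicoherent.{u, u, u, u} (R := X.ringCatSheaf) (M := M)
    { I := ι
      X := U
      coversTop := (Opens.coversTop_iff X U).2 hU
      presentation i := presentationOver M (U i) (h i).some }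

theorem nonempty_presentation_of_iso {X : Scheme.{u}} {M N : X.Modules} (e : M ≅ N)
    (h : Nonempty M.Presentation) : Nonempty N.Presentation :=
  have : @IsIso (SheafOfModules X.ringCatSheaf) _ M N e.hom := (inferInstance : IsIso e.hom)
  h.map (SheafOfModules.Presentation.ofIsIso.{u, u, u} e.hom)

theorem nonempty_presentation_of_isQuasicoherent {R : CommRingCat.{u}} (M : (Spec R).Modules)
    [M.IsQuasicoherent] : Nonempty M.Presentation :=
  have := (isQuasicoherent_iff_isIso_fromTildeΓ M).1 inferInstance
  nonempty_presentation_of_iso (asIso M.fromTildeΓ)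
    ⟨presentationTilde.{u} _ .univ (by simp) _ (Submodule.span_eq _)⟩

theorem isQuasicoherent_of_isAffineOpen {X : Scheme.{u}} (M : X.Modules)
    (h : ∀ {U : X.Opens} (hU : IsAffineOpen U), (M.restrict hU.fromSpec).IsQuasicoherent) :
    M.IsQuasicoherent := by
  refine isQuasicoherent_of_isOpenCover M (iSup_affineOpens_eq_top X) fun U => ?_
  have hU : IsAffineOpen U.1 := U.2
  have := h hU
  let e : Scheme.Modules.restrictFunctor hU.fromSpec ⋙
      Scheme.Modules.restrictFunctor hU.isoSpec.hom ≅ Scheme.Modules.restrictFunctor U.1.ι :=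
    (Scheme.Modules.restrictFunctorComp _ _).symm ≪≫
      Scheme.Modules.restrictFunctorCongr (by simp)
  exact nonempty_presentation_of_iso (e.app M) <|
    (nonempty_presentation_of_isQuasicoherent (M.restrict hU.fromSpec)).map
      (Scheme.Modules.presentationRestrict hU.isoSpec.hom)

theorem isQuasicoherent_omegaSheaf (X : Over (Spec (.of k))) : (omegaSheaf X).IsQuasicoherent :=
  isQuasicoherent_of_isAffineOpen _ fun {U} hU => by
    let φ : CommRingCat.of k ⟶ Γ(X.left, U) := Spec.preimage (hU.fromSpec ≫ X.hom)
    let f : specOver φ ⟶ X := Over.homMk hU.fromSpec (by simp [φ])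
    have : IsOpenImmersion f.left := inferInstanceAs (IsOpenImmersion hU.fromSpec)
    exact isQuasicoherent_restrict_omegaSheaf f

end Quasicoherence

section Smoothness

/-- The isomorphism of functors `D_X ≅ D_{Ω_{X/k}}` given by `𝒳 ↦ (𝒳, Ω_{𝒳/k})`; its inverse forgets
the sheaf. -/
def defIsoFiberedDef (X : Over (Spec (.of k))) : defFunctor X ≅ fiberedDefFunctor X where
  hom :=
    { app A := TypeCat.ofHom <| Quotient.map FiberedDeformation.ofDeformation fun _ _ h =>
        (FiberedDeformation.nonempty_iso_iff _ _).2 h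
      naturality A B f := by
        ext ⟨D⟩
        rfl }
  inv :=
    { app A := TypeCat.ofHom <| Quotient.map FiberedDeformation.deformation fun _ _ h =>
        (FiberedDeformation.nonempty_iso_iff _ _).1 h
      naturality A B f := by
        ext ⟨E⟩
        rfl }
  hom_inv_id := by
    ext A ⟨D⟩
    rfl
  inv_hom_id := by
    ext A ⟨E⟩
    exact Quotient.sound ((FiberedDeformation.nonempty_iso_iff _ _).2 (Setoid.refl _))

theorem isSmoothTrans_of_iso {F G : Art k ⥤ Type (u + 1)} (θ : F ≅ G) : IsSmoothTrans θ.hom := by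
  intro B A f _ x y h
  refine ⟨θ.inv.app B y, ?_, congr($(θ.inv_hom_id_app B) y)⟩
  calc F.map f (θ.inv.app B y) = θ.inv.app A (G.map f y) := congr($(θ.inv.naturality f) y).symm
    _ = θ.inv.app A (θ.hom.app A x) := by rw [h]
    _ = x := congr($(θ.hom_inv_id_app A) x)

end Smoothness

end OmegaSmooth

end

theorem mainTheorem7_general (k : Type u) [Field k] :
    (∀ X : Over (Spec (.of k)), isQCoh k ((omega k).obj X)) ∧
      ∀ X : Over (Spec (.of k)), ∃ θ : defFunctor X ≅ fiberedDefFunctor X,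
        ∀ (A : Art k) (D : Deformation X A),
          θ.hom.app A (Quotient.mk _ D) = Quotient.mk _ (FiberedDeformation.ofDeformation D) :=
  ⟨isQuasicoherent_omegaSheaf, fun X => ⟨defIsoFiberedDef X, fun _ _ => rfl⟩⟩

theorem mainTheorem7 (k : Type u) [Field k] :
    ∃ h : ∀ X : Over (Spec (.of k)), isQCoh k ((omega k).obj X),
      IsSmoothFunctor (C := QCoh k) ((isQCoh k).lift (omega k) h)
        (fun E => fiberedDefFunctor E.obj.base)
        (fun _ _ D => Quotient.mk _ (FiberedDeformation.ofDeformation D)) :=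
  let ⟨h, hθ⟩ := mainTheorem7_general k
  ⟨h, fun X => (hθ X).elim fun θ hθ => ⟨θ.hom, hθ, isSmoothTrans_of_iso θ⟩⟩
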